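/- For integers $m,n$ let $BS(m,n)=\langle a,b \mid ba^{m}b^{-1}=a^{n}\rangle$. Let $G$ be a group generated by a set $S$, and put $S^{\pm1}=(S\cup S^{-1})\setminus\{e\}$. For $\ell>2$ and $s_1,\dots,s_\ell\in S^{\pm1}$, call $s_1\cdots s_\ell=e$ a simple relation if, for $1\le p\le q\le \ell$, one has $s_p\cdots s_q=e$ if and only if $(p,q)=(1,\ell)$. For $k\in\mathbb N$, the group $G$ is called $k$-chordal with respect to $S$ if for every simple relation $s_1\cdots s_\ell=e$ in $S^{\pm1}$ with $\ell\ge k$ there exist $1\le i<j\le \ell$ and $s_1',\dots,s_r'\in S^{\pm1}$ (with $r\ge 0$) such that $s_i\cdots s_j=s_1'\cdots s_r'$ and $r\le\min\{\,j-i,\ \ell-j+i-2\,\}$. (Equivalently, every cycle of length at least $k$ in the Cayley graph of $G$ with respect to $S$ has a shortcut: a path joining two vertices of the cycle that is strictly shorter than their distance along the cycle.) Theorem. For every integer $n>2$ and every $k\in\mathbb N$, the group $BS(1,n)=\langle a,b\mid bab^{-1}=a^{n}\rangle$ is not $k$-chordal with respect to $\{a,b\}$. -/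

import Mathlib

open scoped Pointwise

/-- `S^{±1} = (S ∪ S⁻¹) ∖ {e}`. -/
def symmGen {G : Type*} [Group G] (S : Set G) : Set G := (S ∪ S⁻¹) \ {1}

/-- `w` is a word `s_1 ⋯ s_n` in `S^{±1}`. -/
def IsWordIn {G : Type*} [Group G] (S : Set G) (w : List G) : Prop :=
  ∀ s ∈ w, s ∈ symmGen S

/-- The subword `s_i ⋯ s_j` of `w = s_1 ⋯ s_n`
(letters are numbered from `1`; used only for `1 ≤ i ≤ j ≤ n`). -/
def subword {G : Type*} (w : List G) (i j : ℕ) : List G := (w.take j).drop (i - 1)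

/-- `s_1 ⋯ s_n = e` is a simple relation in `S^{±1}`: `n > 2`, every `s_l` lies in `S^{±1}`, and for
`1 ≤ p ≤ q ≤ n` one has `s_p ⋯ s_q = e` if and only if `(p, q) = (1, n)`. -/
def IsSimpleRelation {G : Type*} [Group G] (S : Set G) (w : List G) : Prop :=
  2 < w.length ∧ IsWordIn S w ∧
    ∀ p q : ℕ, 1 ≤ p → p ≤ q → q ≤ w.length →
      ((subword w p q).prod = 1 ↔ p = 1 ∧ q = w.length)

/-- `G` is `(k, m)`-chordal with respect to `S`: for every simple relation `s_1 ⋯ s_n = e` in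
`S^{±1}` with `n ≥ k` there are `1 ≤ i < j ≤ n` and a word `s'_1 ⋯ s'_r` in `S^{±1}` such that
`s_i ⋯ s_j = s'_1 ⋯ s'_r` and `r ≤ min {m, j - i, n - j + i - 2}`.
The bound `r ≤ n - j + i - 2` (in the integers) is written `r + j + 2 ≤ n + i`. -/
def IsKMChordal {G : Type*} [Group G] (S : Set G) (k : ℕ) (m : ℕ∞) : Prop :=
  ∀ w : List G, IsSimpleRelation S w → k ≤ w.length →
    ∃ i j : ℕ, 1 ≤ i ∧ i < j ∧ j ≤ w.length ∧
      ∃ v : List G, IsWordIn S v ∧ (subword w i j).prod = v.prod ∧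
        (v.length : ℕ∞) ≤ m ∧ v.length ≤ j - i ∧ v.length + j + 2 ≤ w.length + i

/-- `G` is `k`-chordal with respect to `S`: the case `m = ∞`. -/
def IsKChordal {G : Type*} [Group G] (S : Set G) (k : ℕ) : Prop := IsKMChordal S k ⊤

/-- The two letters of the Baumslag–Solitar presentation. -/
inductive BSLetter : Type
  | a
  | b

/-- The Baumslag–Solitar group `BS(m, n) = ⟨a, b ∣ b a^m b⁻¹ = a^n⟩`. -/
abbrev BaumslagSolitar (m n : ℤ) : Type :=
  PresentedGroup
    ({FreeGroup.of BSLetter.b * FreeGroup.of BSLetter.a ^ m * (FreeGroup.of BSLetter.b)⁻¹ *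
      (FreeGroup.of BSLetter.a ^ n)⁻¹} : Set (FreeGroup BSLetter))

/-- The standard generating set `{a, b}` of `BS(m, n)`. -/
def BaumslagSolitar.gens (m n : ℤ) : Set (BaumslagSolitar m n) :=
  {PresentedGroup.of BSLetter.a, PresentedGroup.of BSLetter.b}

/-! ### Geodesic cycles have no shortcuts -/

section WordLength

variable {G : Type*} [Group G] {S : Set G}

/-! Arbitrarily long geodesic cycles rule out chordality. The cycle used is the commutator of `b ^ m
* a * b ^ (-m)`, a power of `a`, with `a`; its length is `2 * N` with `N = 2 * m + 2`. A shortcut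
would extend along the cycle to a short path between antipodal vertices, so it suffices that these
lie at distance `N` (`le_length_of_antipodal`).

In the affine action on `ℚ`, each half of the cycle is a translation by `D / n ^ h` with `D = n ^ m
+ 1` or `D = 1 - n ^ m`. A word for it is a closed walk of heights from `h`, a horizontal step at
height `l` adding `± n ^ l` to `D`. As `n ∤ D`, some horizontal step occurs at height at most `0`
and adds at most `1`. If `M` is the top height, the `s` horizontal steps give `|D| ≤ (s - 1) * n ^ M
+ 1`, and there are at least `2 * M` vertical steps. For `n ≥ 3` this forces `s + 2 * M ≥ 2 * m +
2`. -/

theorem inv_mem_symmGen {s : G} (hs : s ∈ symmGen S) : s⁻¹ ∈ symmGen S := by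
  obtain ⟨h, h1⟩ := hs
  refine ⟨?_, by simpa using h1⟩
  rcases h with h | h
  · exact Or.inr (by simpa using h)
  · exact Or.inl h

theorem IsWordIn.append {u v : List G} (hu : IsWordIn S u) (hv : IsWordIn S v) :
    IsWordIn S (u ++ v) := by
  intro s hs
  rcases List.mem_append.1 hs with h | h
  · exact hu s h
  · exact hv s h

theorem IsWordIn.inverse {u : List G} (hu : IsWordIn S u) :
    IsWordIn S (u.map (·⁻¹)).reverse := by
  intro s hs
  obtain ⟨t, ht, rfl⟩ := List.mem_map.1 (List.mem_reverse.1 hs)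
  exact inv_mem_symmGen (hu t ht)

theorem prod_inverse (u : List G) : (u.map (·⁻¹)).reverse.prod = u.prod⁻¹ := by
  rw [List.prod_inv_reverse]

theorem prod_take_eq (w : List G) {x y : ℕ} (hxy : x ≤ y) :
    (w.take y).prod = (w.take x).prod * ((w.take y).drop x).prod := by
  conv_lhs => rw [← List.take_append_drop x (w.take y)]
  rw [List.prod_append, List.take_take, min_eq_left hxy]

/-- If antipodal vertices of a closed path of length `2 * N` are at distance `N`,
then the distance between two vertices of the path is their distance along the path. -/
theorem le_length_of_antipodal {w : List G} {N : ℕ} (hw : IsWordIn S w)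
    (hlen : w.length = 2 * N) (hprod : w.prod = 1)
    (hanti : ∀ p < N, ∀ v, IsWordIn S v → v.prod = ((w.drop p).take N).prod → N ≤ v.length)
    {x y : ℕ} (hxy : x < y) (hy : y ≤ 2 * N) {v : List G} (hv : IsWordIn S v)
    (hvp : v.prod = ((w.take y).drop x).prod) :
    y ≤ x + v.length ∨ 2 * N + x ≤ y + v.length := by
  have hsub : ∀ i j, IsWordIn S ((w.take i).drop j) := fun i j s hs =>
    hw s (List.mem_of_mem_take (List.mem_of_mem_drop hs))
  have hslen : ∀ i j, i ≤ 2 * N → ((w.take i).drop j).length = i - j := by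
    intro i j hi
    simp only [List.length_drop, List.length_take, hlen]
    omega
  have hwin : ∀ p, (w.drop p).take N = (w.take (p + N)).drop p := by
    intro p
    rw [List.drop_take]
    simp
  have hpre : ∀ p ≤ N, ∀ v, IsWordIn S v →
      (w.take p).prod * v.prod = (w.take (p + N)).prod → N ≤ v.length := by
    intro p hp v hv hvp
    rcases hp.lt_or_eq with hp | rfl
    · refine hanti p hp v hv ?_
      rw [hwin]
      rw [prod_take_eq w (Nat.le_add_right p N)] at hvp
      exact mul_left_cancel hvp
    -- The half starting at `N` is the inverse of the half starting at `0`, as the whole word is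
    -- trivial.
    · rcases Nat.eq_zero_or_pos p with rfl | hpos
      · exact Nat.zero_le _
      have := hanti 0 hpos _ hv.inverse ?_
      · simpa using this
      · rw [prod_inverse]
        rw [← two_mul, ← hlen, List.take_length, hprod] at hvp
        rw [List.drop_zero]
        exact (eq_inv_of_mul_eq_one_left hvp).symm
  have hvp' : (w.take y).prod = (w.take x).prod * v.prod := by
    rw [hvp, ← prod_take_eq w hxy.le]
  by_contra hcon
  push Not at hcon
  -- Complete `v` to a path between antipodal vertices: forward from `y`, backward from `x`, or back
  -- from `y` to `x + N`.
  rcases le_or_gt y (x + N) with hd | hd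
  · rcases le_or_gt x N with hx | hx
    · have := hpre x hx _ (hv.append (hsub (x + N) y)) (by
        rw [List.prod_append, ← mul_assoc, ← hvp', ← prod_take_eq w hd])
      rw [List.length_append, hslen _ _ (by omega)] at this
      omega
    · have := hpre (y - N) (by omega) _ ((hsub x (y - N)).append hv) (by
        rw [List.prod_append, ← mul_assoc, ← prod_take_eq w (by omega), ← hvp',
          Nat.sub_add_cancel (by omega)])
      rw [List.length_append, hslen _ _ (by omega)] at this
      omega
  · have := hpre x (by omega) _ (hv.append (hsub y (x + N)).inverse) (by
      rw [List.prod_append, ← mul_assoc, ← hvp', prod_inverse, prod_take_eq w hd.le,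
        mul_inv_cancel_right])
    rw [List.length_append, List.length_reverse, List.length_map, hslen _ _ (by omega)] at this
    omega

theorem not_isKChordal_of_antipodal {w : List G} {N k : ℕ} (hN : 2 ≤ N) (hw : IsWordIn S w)
    (hlen : w.length = 2 * N) (hprod : w.prod = 1) (hk : k ≤ w.length)
    (hanti : ∀ p < N, ∀ v, IsWordIn S v → v.prod = ((w.drop p).take N).prod → N ≤ v.length) :
    ¬ IsKChordal S k := by
  intro h
  have hsimple : IsSimpleRelation S w := by
    refine ⟨by omega, hw, fun p q hp hpq hq => ⟨fun h1 => ?_, ?_⟩⟩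
    -- A trivial proper subword would be a shortcut of length `0`.
    · have := le_length_of_antipodal (x := p - 1) (y := q) (v := []) hw hlen hprod hanti
        (by omega) (by omega) (by simp [IsWordIn]) (by simpa [subword] using h1.symm)
      simp only [List.length_nil] at this
      omega
    · rintro ⟨rfl, rfl⟩
      simpa [subword] using hprod
  obtain ⟨i, j, hi, hij, hj, v, hv, hvp, -, h1, h2⟩ := h w hsimple hk
  have := le_length_of_antipodal (x := i - 1) (y := j) hw hlen hprod hanti
    (by omega) (by omega) hv hvp.symm
  omega

end WordLength

namespace BaumslagSolitar

/-! ### The affine action on `ℚ` -/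

theorem conj_relation (n : ℤ) :
    (PresentedGroup.of BSLetter.b * PresentedGroup.of BSLetter.a *
      (PresentedGroup.of BSLetter.b)⁻¹ : BaumslagSolitar 1 n) =
      PresentedGroup.of BSLetter.a ^ n := by
  have h := PresentedGroup.one_of_mem (rels :=
    ({FreeGroup.of BSLetter.b * FreeGroup.of BSLetter.a ^ (1 : ℤ) * (FreeGroup.of BSLetter.b)⁻¹ *
      (FreeGroup.of BSLetter.a ^ n)⁻¹} : Set (FreeGroup BSLetter))) (Set.mem_singleton _)
  rw [map_mul, map_inv, map_zpow, map_mul, map_mul, map_inv, map_zpow, zpow_one] at h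
  exact mul_inv_eq_one.1 h

theorem conj_pow (n : ℤ) (m : ℕ) :
    (PresentedGroup.of BSLetter.b ^ m * PresentedGroup.of BSLetter.a *
      (PresentedGroup.of BSLetter.b ^ m)⁻¹ : BaumslagSolitar 1 n) =
      PresentedGroup.of BSLetter.a ^ (n ^ m) := by
  induction m with
  | zero => simp
  | succ m ih =>
    rw [pow_succ', mul_inv_rev, pow_succ', zpow_mul, ← conj_relation, conj_zpow, ← ih]
    group

/-- The generators act on `ℚ` by `a x = x + 1` and `b x = n x`. -/
def actLetter (n : ℤ) (hn : (n : ℚ) ≠ 0) : BSLetter → Equiv.Perm ℚ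
  | BSLetter.a => Equiv.addRight 1
  | BSLetter.b => Equiv.mulLeft₀ (n : ℚ) hn

/-- The action of `BS(1, n)` on `ℚ` by affine maps. -/
def act (n : ℤ) (hn : (n : ℚ) ≠ 0) : BaumslagSolitar 1 n →* Equiv.Perm ℚ :=
  PresentedGroup.toGroup (f := actLetter n hn) (by
    rintro r rfl
    simp only [map_mul, map_inv, map_zpow, FreeGroup.lift_apply_of, zpow_one]
    rw [mul_inv_eq_one, mul_inv_eq_iff_eq_mul]
    ext x
    simp [actLetter, mul_add])

variable {n : ℤ} (hn : (n : ℚ) ≠ 0)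

theorem act_a (x : ℚ) : act n hn (PresentedGroup.of BSLetter.a) x = x + 1 := by
  rw [act, PresentedGroup.toGroup.of]
  rfl

theorem act_b (x : ℚ) : act n hn (PresentedGroup.of BSLetter.b) x = n * x := by
  rw [act, PresentedGroup.toGroup.of]
  rfl

theorem act_a_inv (x : ℚ) : act n hn (PresentedGroup.of BSLetter.a)⁻¹ x = x - 1 := by
  rw [map_inv, Equiv.Perm.inv_eq_iff_eq, act_a]
  ring

theorem act_b_inv (x : ℚ) : act n hn (PresentedGroup.of BSLetter.b)⁻¹ x = (n : ℚ)⁻¹ * x := by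
  rw [map_inv, Equiv.Perm.inv_eq_iff_eq, act_b, mul_inv_cancel_left₀ hn]

theorem act_b_pow (m : ℕ) (x : ℚ) :
    act n hn (PresentedGroup.of BSLetter.b ^ m) x = (n : ℚ) ^ m * x := by
  induction m generalizing x with
  | zero => simp
  | succ m ih => rw [pow_succ, map_mul, Equiv.Perm.mul_apply, ih, act_b, pow_succ, mul_assoc]

theorem act_b_inv_pow (m : ℕ) (x : ℚ) :
    act n hn ((PresentedGroup.of BSLetter.b)⁻¹ ^ m) x = ((n : ℚ) ^ m)⁻¹ * x := by
  rw [inv_pow, map_inv, Equiv.Perm.inv_eq_iff_eq, act_b_pow,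
    mul_inv_cancel_left₀ (pow_ne_zero m hn)]

theorem a_mem_symmGen (hn : (n : ℚ) ≠ 0) :
    PresentedGroup.of BSLetter.a ∈ symmGen (gens 1 n) := by
  refine ⟨Or.inl (Or.inl rfl), fun h => ?_⟩
  have := act_a hn 0
  rw [Set.mem_singleton_iff.1 h] at this
  simp at this

theorem b_mem_symmGen (hn : 2 < n) :
    PresentedGroup.of BSLetter.b ∈ symmGen (gens 1 n) := by
  have hn0 : (n : ℚ) ≠ 0 := by exact_mod_cast (by omega : n ≠ 0)
  refine ⟨Or.inl (Or.inr rfl), fun h => ?_⟩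
  have := act_b hn0 1
  rw [Set.mem_singleton_iff.1 h] at this
  simp only [map_one, Equiv.Perm.one_apply, mul_one] at this
  have : n = 1 := by exact_mod_cast this.symm
  omega

theorem eq_of_mem_symmGen {s : BaumslagSolitar 1 n} (hs : s ∈ symmGen (gens 1 n)) :
    s = PresentedGroup.of BSLetter.a ∨ s = (PresentedGroup.of BSLetter.a)⁻¹ ∨
      s = PresentedGroup.of BSLetter.b ∨ s = (PresentedGroup.of BSLetter.b)⁻¹ := by
  rcases hs.1 with (h | h) | h
  · exact Or.inl h
  · exact Or.inr (Or.inr (Or.inl h))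
  · rcases h with h | h
    · exact Or.inr (Or.inl (inv_eq_iff_eq_inv.1 h))
    · exact Or.inr (Or.inr (Or.inr (inv_eq_iff_eq_inv.1 h)))

/-! ### Words as walks -/

/-- A word read from height `l₀` is a walk from `l₀` to `l₁` between the heights `μ` and `M`,
with `β` vertical and `s` horizontal steps, and total horizontal displacement `T`. -/
structure IsWalk (n : ℤ) (f : Equiv.Perm ℚ) (l₀ l₁ M μ : ℤ) (s β : ℕ) (T : ℚ) : Prop where
  apply_eq : ∀ x, (n : ℚ) ^ l₀ * f x = (n : ℚ) ^ l₁ * x + T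
  min_le_start : μ ≤ l₀
  start_le_max : l₀ ≤ M
  min_le_end : μ ≤ l₁
  end_le_max : l₁ ≤ M
  vertical : 2 * (M - μ) ≤ β + |l₁ - l₀|
  displacement : (|T| ≤ s * (n : ℚ) ^ M ∧ ∃ z : ℤ, T = n * z) ∨
    (μ ≤ 0 ∧ 1 ≤ s ∧ |T| ≤ (s - 1) * (n : ℚ) ^ M + 1)

/-- A step at positive height keeps the displacement a multiple of `n`; the first step prepended at
height at most `0` is the one bounded by `1` instead of `n ^ M`. -/
theorem IsWalk.horizontal (hn : 2 < n) {f g : Equiv.Perm ℚ} {l₀ l₁ M μ : ℤ} {s β : ℕ} {T : ℚ}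
    (h : IsWalk n f l₀ l₁ M μ s β T) {ε : ℤ} (hε : |ε| = 1) (hg : ∀ x, g x = f x + ε) :
    IsWalk n g l₀ l₁ M μ (s + 1) β (T + ε * (n : ℚ) ^ l₀) := by
  have hn1 : (1 : ℚ) ≤ n := by exact_mod_cast (by omega : 1 ≤ n)
  have hn0 : (n : ℚ) ≠ 0 := by positivity
  have hε' : |(ε : ℚ)| = 1 := by exact_mod_cast hε
  have habs : |T + ε * (n : ℚ) ^ l₀| ≤ |T| + (n : ℚ) ^ l₀ := by
    refine (abs_add_le _ _).trans_eq ?_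
    rw [abs_mul, hε', one_mul, abs_of_pos (zpow_pos (by linarith : (0 : ℚ) < n) l₀)]
  have hle : (n : ℚ) ^ l₀ ≤ (n : ℚ) ^ M := zpow_le_zpow_right₀ hn1 h.start_le_max
  refine ⟨fun x => ?_, h.min_le_start, h.start_le_max, h.min_le_end, h.end_le_max, h.vertical, ?_⟩
  · rw [hg, mul_add, h.apply_eq]
    ring
  · rw [Nat.cast_succ]
    rcases h.displacement with ⟨h1, z, hz⟩ | ⟨h1, h2, h3⟩
    · rcases le_or_gt l₀ 0 with hl | hl
      · have : (n : ℚ) ^ l₀ ≤ 1 := zpow_le_one_of_nonpos₀ hn1 hl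
        refine Or.inr ⟨h.min_le_start.trans hl, Nat.le_add_left 1 s, ?_⟩
        rw [add_sub_cancel_right]
        linarith
      · refine Or.inl ⟨by linarith, z + ε * n ^ (l₀ - 1).toNat, ?_⟩
        have : (n : ℚ) ^ l₀ = n * (n : ℚ) ^ (l₀ - 1).toNat := by
          rw [← pow_succ', ← zpow_natCast]
          congr 1
          omega
        rw [hz, this]
        push_cast
        ring
    · exact Or.inr ⟨h1, Nat.le_add_left 1 s, by linarith⟩

theorem IsWalk.vertical_step (hn : 2 < n) {f g : Equiv.Perm ℚ} {l₀ l₁ M μ : ℤ} {s β : ℕ} {T : ℚ}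
    (h : IsWalk n f l₀ l₁ M μ s β T) {k : ℤ} (hk : |k - l₀| = 1)
    (hg : ∀ x, (n : ℚ) ^ k * g x = (n : ℚ) ^ l₀ * f x) :
    IsWalk n g k l₁ (max M k) (min μ k) s (β + 1) T := by
  obtain ⟨h1, h2, h3, h4, h5, h6, h7⟩ := h
  have hn1 : (1 : ℚ) ≤ n := by exact_mod_cast (by omega : 1 ≤ n)
  have hle : (n : ℚ) ^ M ≤ (n : ℚ) ^ (max M k) := zpow_le_zpow_right₀ hn1 (le_max_left _ _)
  refine ⟨fun x => (hg x).trans (h1 x), by omega, by omega, by omega, by omega, ?_, ?_⟩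
  · rcases abs_cases (k - l₀) with hc | hc <;> rcases abs_cases (l₁ - l₀) with hc' | hc' <;>
      rcases abs_cases (l₁ - k) with hc'' | hc'' <;> omega
  rcases h7 with ⟨h7, hz⟩ | ⟨h7, h8, h9⟩
  · exact Or.inl ⟨h7.trans (by gcongr), hz⟩
  · have : (1 : ℚ) ≤ s := by exact_mod_cast h8
    refine Or.inr ⟨by omega, h8, h9.trans ?_⟩
    have : (0 : ℚ) ≤ s - 1 := by linarith
    gcongr

theorem exists_isWalk (hn : 2 < n) (hn0 : (n : ℚ) ≠ 0) {v : List (BaumslagSolitar 1 n)}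
    (hv : IsWordIn (gens 1 n) v) (l₀ : ℤ) :
    ∃ l₁ M μ : ℤ, ∃ s β : ℕ, ∃ T : ℚ, v.length = s + β ∧
      IsWalk n (act n hn0 v.prod) l₀ l₁ M μ s β T := by
  induction v generalizing l₀ with
  | nil =>
    refine ⟨l₀, l₀, l₀, 0, 0, 0, rfl, by simp, le_rfl, le_rfl, le_rfl, le_rfl, by simp,
      Or.inl ⟨by simp, 0, by simp⟩⟩
  | cons t v ih =>
    have ih := ih fun s hs => hv s (List.mem_cons_of_mem _ hs)
    rcases eq_of_mem_symmGen (hv t List.mem_cons_self) with rfl | rfl | rfl | rfl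
    · obtain ⟨l₁, M, μ, s, β, T, hl, h⟩ := ih l₀
      refine ⟨l₁, M, μ, s + 1, β, _, by rw [List.length_cons]; omega,
        h.horizontal hn (ε := 1) rfl fun x => ?_⟩
      rw [List.prod_cons, map_mul, Equiv.Perm.mul_apply, act_a]
      simp
    · obtain ⟨l₁, M, μ, s, β, T, hl, h⟩ := ih l₀
      refine ⟨l₁, M, μ, s + 1, β, _, by rw [List.length_cons]; omega,
        h.horizontal hn (ε := -1) rfl fun x => ?_⟩
      rw [List.prod_cons, map_mul, Equiv.Perm.mul_apply, act_a_inv]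
      push_cast
      ring
    · obtain ⟨l₁, M, μ, s, β, T, hl, h⟩ := ih (l₀ + 1)
      refine ⟨l₁, _, _, s, β + 1, T, by rw [List.length_cons]; omega,
        h.vertical_step hn (k := l₀) (by simp) fun x => ?_⟩
      rw [List.prod_cons, map_mul, Equiv.Perm.mul_apply, act_b, zpow_add_one₀ hn0]
      ring
    · obtain ⟨l₁, M, μ, s, β, T, hl, h⟩ := ih (l₀ - 1)
      refine ⟨l₁, _, _, s, β + 1, T, by rw [List.length_cons]; omega,
        h.vertical_step hn (k := l₀) (by simp) fun x => ?_⟩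
      rw [List.prod_cons, map_mul, Equiv.Perm.mul_apply, act_b_inv, zpow_sub_one₀ hn0]
      ring

/-! ### The lower bound on length -/

theorem two_mul_add_one_le_three_pow (d : ℕ) : 2 * d + 1 ≤ 3 ^ d := by
  induction d with
  | zero => simp
  | succ d ih => rw [pow_succ]; omega

/-- Each level by which `M` falls short of `m` saves two vertical steps but multiplies the
horizontal cost by about `n ≥ 3`. -/
theorem horizontal_steps_ge (hn : 2 < n) {m : ℕ} (hm : 2 ≤ m) {M s : ℕ} (hs : 1 ≤ s)
    (h : n ^ m - 1 ≤ (s - 1) * n ^ M + 1) : 2 * m + 2 ≤ s + 2 * M := by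
  rcases le_or_gt m M with hmM | hmM
  · have h9 : (3 : ℤ) ^ 2 ≤ n ^ m :=
      (pow_le_pow_left₀ (by norm_num) (by omega) 2).trans (pow_le_pow_right₀ (by omega) hm)
    have : s ≠ 1 := by
      rintro rfl
      norm_num at h
      omega
    omega
  · obtain ⟨d, rfl⟩ := Nat.exists_eq_add_of_lt hmM
    have hd : (2 * (d + 1 : ℕ) + 1 : ℤ) ≤ n ^ (d + 1) := by
      have := two_mul_add_one_le_three_pow (d + 1)
      exact (by exact_mod_cast this : (2 * (d + 1 : ℕ) + 1 : ℤ) ≤ 3 ^ (d + 1)).trans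
        (pow_le_pow_left₀ (by norm_num) (by omega) _)
    -- For `M = 0` the additive error `2` is not below `n ^ M`; here `m ≥ 2` gives `d ≥ 1`, which
    -- makes up for it.
    rcases Nat.eq_zero_or_pos M with rfl | hM
    · have h9 : (3 : ℤ) * (2 * d + 1) ≤ n ^ (0 + d + 1) := by
        have := two_mul_add_one_le_three_pow d
        rw [zero_add, pow_succ']
        exact mul_le_mul (by omega) ((by exact_mod_cast this : (2 * d + 1 : ℤ) ≤ 3 ^ d).trans
          (pow_le_pow_left₀ (by norm_num) (by omega) _)) (by omega) (by omega)
      rw [pow_zero] at h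
      omega
    · have hM3 : (3 : ℤ) ≤ n ^ M :=
        (by omega : 3 ≤ n).trans (le_self_pow₀ (by omega) (by omega))
      rw [add_assoc, pow_add] at h
      have : n ^ (d + 1) < s := by
        by_contra! hlt
        nlinarith
      omega

/-- A word acting as the translation by `D / n ^ h`, where `D = ± n ^ m ± 1` and `0 ≤ h ≤ m`, has
at least `2 * m + 2` letters. -/
theorem le_length_of_translation (hn : 2 < n) (hn0 : (n : ℚ) ≠ 0) {m : ℕ} (hm : 2 ≤ m) (h : ℕ)
    {D : ℤ} (hD : n ^ m - 1 ≤ |D|) (hdvd : ¬ n ∣ D) {v : List (BaumslagSolitar 1 n)}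
    (hv : IsWordIn (gens 1 n) v) (hact : ∀ x, (n : ℚ) ^ h * act n hn0 v.prod x = n ^ h * x + D) :
    2 * m + 2 ≤ v.length := by
  obtain ⟨l₁, M, μ, s, β, T, hl, hW⟩ := exists_isWalk hn hn0 hv h
  have hn1 : (1 : ℚ) < n := by exact_mod_cast (by omega : 1 < n)
  have happ : ∀ x : ℚ, (n : ℚ) ^ (h : ℤ) * x + D = (n : ℚ) ^ l₁ * x + T := fun x => by
    rw [← hW.apply_eq, zpow_natCast, hact]
  have hT : T = D := by simpa using (happ 0).symm
  have hl₁ : l₁ = h := by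
    have := happ 1
    rw [hT] at this
    exact (zpow_right_injective₀ (by linarith) hn1.ne' (by linarith : (n : ℚ) ^ (h : ℤ) = n ^ l₁)).symm
  have hvert := hW.vertical
  have hM := hW.start_le_max
  rw [hl₁, sub_self, abs_zero] at hvert
  lift M to ℕ using by omega
  -- Since `n ∤ D`, the walk reaches height at most `0`.
  rcases hW.displacement with ⟨-, z, hz⟩ | ⟨h1, h2, h3⟩
  · refine absurd ⟨z, ?_⟩ hdvd
    rw [hT] at hz
    exact_mod_cast hz
  · rw [hT, zpow_natCast] at h3
    have h3' : |D| ≤ (s - 1) * n ^ M + 1 := by exact_mod_cast h3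
    have := horizontal_steps_ge hn hm h2 (hD.trans h3')
    omega

/-! ### The commutator cycle -/

/-- The word of the commutator of `b ^ m * a * b ^ (-m)` and `a`. -/
def commutatorWord (n : ℤ) (m : ℕ) : List (BaumslagSolitar 1 n) :=
  let a : BaumslagSolitar 1 n := PresentedGroup.of BSLetter.a
  let b : BaumslagSolitar 1 n := PresentedGroup.of BSLetter.b
  List.replicate m b ++ [a] ++ List.replicate m b⁻¹ ++ [a] ++
    List.replicate m b ++ [a⁻¹] ++ List.replicate m b⁻¹ ++ [a⁻¹]

theorem length_commutatorWord (m : ℕ) : (commutatorWord n m).length = 2 * (2 * m + 2) := by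
  simp [commutatorWord]
  omega

theorem isWordIn_commutatorWord (hn : 2 < n) (hn0 : (n : ℚ) ≠ 0) (m : ℕ) :
    IsWordIn (gens 1 n) (commutatorWord n m) := by
  intro s hs
  have : s = PresentedGroup.of BSLetter.a ∨ s = (PresentedGroup.of BSLetter.a)⁻¹ ∨
      s = PresentedGroup.of BSLetter.b ∨ s = (PresentedGroup.of BSLetter.b)⁻¹ := by
    simp only [commutatorWord, List.mem_append, List.mem_replicate, List.mem_singleton] at hs
    tauto
  rcases this with rfl | rfl | rfl | rfl
  · exact a_mem_symmGen hn0
  · exact inv_mem_symmGen (a_mem_symmGen hn0)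
  · exact b_mem_symmGen hn
  · exact inv_mem_symmGen (b_mem_symmGen hn)

theorem prod_commutatorWord (m : ℕ) : (commutatorWord n m).prod = 1 := by
  have h := conj_pow n m
  have hc := (Commute.refl (PresentedGroup.of BSLetter.a : BaumslagSolitar 1 n)).zpow_left (n ^ m)
  rw [← h] at hc
  simp only [commutatorWord, List.prod_append, List.prod_replicate, List.prod_singleton, inv_pow]
  rw [hc.eq]
  group

theorem le_length_of_prod_eq_window (hn : 2 < n) (hn0 : (n : ℚ) ≠ 0) {m : ℕ} (hm : 2 ≤ m) {p : ℕ}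
    (hp : p < 2 * m + 2) {v : List (BaumslagSolitar 1 n)} (hv : IsWordIn (gens 1 n) v)
    (hvp : v.prod = (((commutatorWord n m).drop p).take (2 * m + 2)).prod) :
    2 * m + 2 ≤ v.length := by
  set a : BaumslagSolitar 1 n := PresentedGroup.of BSLetter.a with ha
  set b : BaumslagSolitar 1 n := PresentedGroup.of BSLetter.b with hb
  have hpow : (9 : ℤ) ≤ n ^ m :=
    (pow_le_pow_left₀ (by norm_num) (by omega : (3 : ℤ) ≤ n) 2).trans
      (pow_le_pow_right₀ (by omega) hm)
  have hnd1 : ¬ n ∣ 1 := fun h => by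
    have := Int.le_of_dvd one_pos h
    omega
  have hndvd : n ∣ n ^ m := dvd_pow_self n (by omega)
  have hwindow : ∀ l₁ l₂ l₃ : List (BaumslagSolitar 1 n), commutatorWord n m = l₁ ++ (l₂ ++ l₃) →
      l₁.length = p → l₂.length = 2 * m + 2 → v.prod = l₂.prod := by
    intro l₁ l₂ l₃ h h1 h2
    rw [hvp, h, ← h1, List.drop_left, ← h2, List.take_left]
  rcases le_or_gt p m with hpm | hpm
  -- The window starts on the first ascent, at height `p`.
  · obtain ⟨d, rfl⟩ := Nat.exists_eq_add_of_le hpm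
    have hprod := hwindow (List.replicate p b)
      (List.replicate d b ++ ([a] ++ (List.replicate (p + d) b⁻¹ ++ ([a] ++ List.replicate p b))))
      (List.replicate d b ++ ([a⁻¹] ++ (List.replicate (p + d) b⁻¹ ++ [a⁻¹])))
      (by
        simp only [commutatorWord, ← ha, ← hb, List.append_assoc]
        rw [List.replicate_add p d b]
        simp only [List.append_assoc])
      (by simp) (by simp; omega)
    refine le_length_of_translation hn hn0 hm p (D := n ^ (p + d) + 1)
      (by rw [abs_of_pos (by omega)]; omega) (fun h => hnd1 ((Int.dvd_add_right hndvd).1 h)) hv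
      fun x => ?_
    rw [hprod]
    simp only [List.prod_append, List.prod_replicate, List.prod_singleton, map_mul,
      Equiv.Perm.mul_apply, ha, hb, act_a, act_b_pow, act_b_inv_pow]
    push_cast
    rw [pow_add]
    field_simp
    ring
  -- The window starts on the first descent, at height `h = m - j`.
  · obtain ⟨j, rfl⟩ := Nat.exists_eq_add_of_lt hpm
    obtain ⟨h, rfl⟩ := Nat.exists_eq_add_of_le (show j ≤ m by omega)
    have hprod := hwindow
      (List.replicate (j + h) b ++ ([a] ++ List.replicate j b⁻¹))
      (List.replicate h b⁻¹ ++ ([a] ++ (List.replicate (j + h) b ++ ([a⁻¹] ++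
        List.replicate j b⁻¹))))
      (List.replicate h b⁻¹ ++ [a⁻¹])
      (by
        simp only [commutatorWord, ← ha, ← hb, List.append_assoc]
        rw [List.replicate_add j h b⁻¹]
        simp only [List.append_assoc])
      (by simp; omega) (by simp; omega)
    refine le_length_of_translation hn hn0 hm h (D := 1 - n ^ (j + h))
      (by rw [abs_of_neg (by omega)]; omega)
      (fun h => hnd1 ((Int.dvd_iff_dvd_of_dvd_sub (by simpa using hndvd.neg_right)).1 h)) hv
      fun x => ?_
    rw [hprod]
    simp only [List.prod_append, List.prod_replicate, List.prod_singleton, map_mul,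
      Equiv.Perm.mul_apply, ha, hb, act_a, act_a_inv, act_b_pow, act_b_inv_pow]
    push_cast
    rw [pow_add]
    field_simp
    ring

end BaumslagSolitar

theorem theorem5p10 (n : ℤ) (hn : 2 < n) (k : ℕ) :
    ¬ IsKChordal (BaumslagSolitar.gens 1 n) k := by
  have hn0 : (n : ℚ) ≠ 0 := by exact_mod_cast (by omega : n ≠ 0)
  -- `m = k + 2` gives both `m ≥ 2` and length at least `k`.
  refine not_isKChordal_of_antipodal (N := 2 * (k + 2) + 2) (by omega)
    (BaumslagSolitar.isWordIn_commutatorWord hn hn0 (k + 2))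
    (BaumslagSolitar.length_commutatorWord (k + 2)) (BaumslagSolitar.prod_commutatorWord (k + 2))
    (by rw [BaumslagSolitar.length_commutatorWord]; omega) fun p hp v hv hvp => ?_
  exact BaumslagSolitar.le_length_of_prod_eq_window hn hn0 (by omega) hp hv hvp
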